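/- Let $\mathbb T=\mathbb R/2\pi\mathbb Z$, write $\widehat f(k)=\frac1{2\pi}\int_{\mathbb T}f(\xi)e^{-ik\xi}\,d\xi$ and $\|f\|_{H^s}^2=\sum_{k\in\mathbb Z}(1+|k|^2)^s|\widehat f(k)|^2$. Let $\Lambda$, $\mathcal H$ and $\mathcal T=(I+\Upsilon\Lambda)^{-1}\Lambda$ be the Fourier multipliers on $\mathbb T$ with symbols $|k|$, $-i\,\mathrm{sgn}(k)$ and $|k|/(1+\Upsilon|k|)$, let $[\Lambda,f]g=\Lambda(fg)-f\Lambda g$, and let $\alpha,\gamma$ be the Fourier multipliers with symbols $$\alpha_k=\frac{-\delta|k|}{\delta^2|k|^4+4(1+\Upsilon|k|)^2},\qquad \gamma_k=\frac{2(1+\Upsilon|k|)}{|k|\big(\delta^2|k|^4+4(1+\Upsilon|k|)^2\big)}\qquad(k\neq0),$$ the operator $\alpha+\gamma\mathcal H$ being $0$ on the zero mode. For $\varepsilon>0$ consider the equation $$F_\tau=\tfrac1\varepsilon(\alpha+\gamma\mathcal H)\Big[(I+\Upsilon\Lambda)F_{\xi\xi}+\tfrac\beta4\Lambda F_{\xi\xi\xi\xi}+\delta\Lambda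 F_{\xi\xi\xi}+\Lambda F\Big]-(\alpha+\gamma\mathcal H)\,\mathcal N_1(F),$$ $$\mathcal N_1(F)=\tfrac12\Lambda\big(F_\xi^2-(\Lambda F)^2\big)-[\Lambda,F_\xi]F_\xi+F_{\xi\xi}\Lambda F+[\Lambda,F]\mathcal TF-F_\xi\mathcal H\mathcal TF+\tfrac\beta4\big([\Lambda,F]\mathcal TF_{\xi\xi\xi\xi}-F_\xi\Lambda\mathcal TF_{\xi\xi\xi}\big)+\delta\big([\Lambda,F]\mathcal TF_{\xi\xi\xi}-F_\xi\Lambda\mathcal TF_{\xi\xi}\big).$$ A global solution with initial datum $F_0$ is a function $F\in C([0,\infty);H^3(\mathbb T))$ with $F(\cdot,0)=F_0$ that satisfies the equation in the sense of periodic distributions for every $\tau\ge0$, that is, every Fourier coefficient of $F$ is differentiable in $\tau$ on $[0,\infty)$ (one-sidedly at $\tau=0$), with derivative the corresponding Fourier coefficient of the right-hand side; there, products are given by convolution of Fourier coefficients. **Theorem.** Let $\Upsilon,\delta,\beta>0$. There exists $\varepsilon_\ast=\varepsilon_\ast(\Upsilon,\delta,\beta)>0$ such that for every $\varepsilon>0$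 and every (complex-valued) $F_0\in H^3(\mathbb T)$ with zero spatial mean and $$\varepsilon\,\|F_0\|_{H^3(\mathbb T)}\le\varepsilon_\ast$$ (so $\|F_0\|_{H^3}\le\varepsilon_\ast$ if $\varepsilon=1$, and $\|F_0\|_{H^3}\le\varepsilon_\ast$ suffices if $0<\varepsilon\le1$) there is a global solution $F\in C([0,\infty);H^3(\mathbb T))$ with $F(\cdot,0)=F_0$, and it is unique among all global solutions with initial datum $F_0$. If $F_0$ is real valued, then so is $F(\cdot,\tau)$ for every $\tau\ge0$. -/

import Mathlib

open MeasureTheory Filter Topology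

noncomputable section

namespace Hydroelastic

/-- The one-dimensional torus `ℝ / 2πℤ`. -/
abbrev Torus : Type := AddCircle (2 * Real.pi)

instance fact_two_pi_pos : Fact (0 < 2 * Real.pi) := ⟨Real.two_pi_pos⟩

/-- Complex square-integrable functions on the torus, modulo equality almost everywhere
(the reference measure is normalized Lebesgue measure `dξ / 2π`). -/
abbrev L2Torus : Type :=
  Lp ℂ 2 (AddCircle.haarAddCircle : Measure (AddCircle (2 * Real.pi)))

/-- Fourier coefficients `f̂(k) = (1 / 2π) ∫ f(ξ) e^{-ikξ} dξ`. -/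
def coeff (f : L2Torus) : ℤ → ℂ := fun k => fourierCoeff (f : Torus → ℂ) k

/-- `f` is real valued. -/
def IsRealValued (f : L2Torus) : Prop :=
  ∀ᵐ x ∂(AddCircle.haarAddCircle : Measure (AddCircle (2 * Real.pi))), ((f : Torus → ℂ) x).im = 0

/-- `f` has zero spatial mean: `(1 / 2π) ∫ f = 0`. -/
def MeanZero (f : L2Torus) : Prop :=
  ∫ x, (f : Torus → ℂ) x ∂(AddCircle.haarAddCircle : Measure (AddCircle (2 * Real.pi))) = 0

/-- `f ∈ H^s`, that is, `∑ (1 + |k|²)^s |f̂(k)|² < ∞`. -/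
def MemSobolev (s : ℝ) (f : L2Torus) : Prop :=
  Summable fun k : ℤ => (1 + (k : ℝ) ^ 2) ^ s * ‖coeff f k‖ ^ 2

/-- The norm `‖f‖_{H^s} = (∑ (1 + |k|²)^s |f̂(k)|²)^{1/2}` (meaningful for `f ∈ H^s`). -/
def sobolevNorm (s : ℝ) (f : L2Torus) : ℝ :=
  Real.sqrt (∑' k : ℤ, (1 + (k : ℝ) ^ 2) ^ s * ‖coeff f k‖ ^ 2)

/-- `F ∈ C([0,∞); H^s)`. -/
def ContinuousInSobolev (s : ℝ) (F : ℝ → L2Torus) : Prop :=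
  (∀ τ : ℝ, 0 ≤ τ → MemSobolev s (F τ)) ∧
  ∀ τ : ℝ, 0 ≤ τ →
    Tendsto (fun σ => sobolevNorm s (F σ - F τ)) (𝓝[Set.Ici 0] τ) (𝓝 0)

/-! ### Operators on Fourier series

Functions and distributions on the torus are represented here by the sequence of their
Fourier coefficients, so that objects of negative Sobolev regularity are allowed. -/

/-- `∂_ξ`, with symbol `i k`. -/
def dxi (u : ℤ → ℂ) : ℤ → ℂ := fun k => Complex.I * (k : ℂ) * u k

/-- `Λ`, with symbol `|k|`. -/
def lam (u : ℤ → ℂ) : ℤ → ℂ := fun k => ((|(k : ℝ)| : ℝ) : ℂ) * u k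

/-- The Hilbert transform, with symbol `-i sgn k`. -/
def hilb (u : ℤ → ℂ) : ℤ → ℂ := fun k => -Complex.I * ((Int.sign k : ℤ) : ℂ) * u k

/-- `𝒯 = (I + ΥΛ)⁻¹ Λ`, with symbol `|k| / (1 + Υ|k|)`. -/
def tee (Υ : ℝ) (u : ℤ → ℂ) : ℤ → ℂ :=
  fun k => ((|(k : ℝ)| / (1 + Υ * |(k : ℝ)|) : ℝ) : ℂ) * u k

/-- The product of two functions or distributions, in terms of Fourier coefficients:
`(u v)^(k) = ∑_j û(j) v̂(k - j)`. The series converges absolutely if `u ∈ H^s` and `v ∈ H^{-s}`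
for some real `s`; this covers all products below when `F ∈ H³`. -/
def prod (u v : ℤ → ℂ) : ℤ → ℂ := fun k => ∑' j : ℤ, u j * v (k - j)

/-- The commutator `[Λ, f] g = Λ(f g) - f Λg`. -/
def commLam (f g : ℤ → ℂ) : ℤ → ℂ := lam (prod f g) - prod f (lam g)

/-- The real symbol `α_k`. -/
def alphaSymb (Υ δ : ℝ) (k : ℤ) : ℝ :=
  -(δ * |(k : ℝ)|) / (δ ^ 2 * |(k : ℝ)| ^ 4 + 4 * (1 + Υ * |(k : ℝ)|) ^ 2)

/-- The real symbol `γ_k` for `k ≠ 0`. (The value of the formula at `k = 0` is irrelevant, since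
`γ` is only ever composed with the Hilbert transform, which annihilates the zero mode.) -/
def gammaSymb (Υ δ : ℝ) (k : ℤ) : ℝ :=
  2 * (1 + Υ * |(k : ℝ)|) /
    (|(k : ℝ)| * (δ ^ 2 * |(k : ℝ)| ^ 4 + 4 * (1 + Υ * |(k : ℝ)|) ^ 2))

/-- The operator `α + γ ℋ`. -/
def alphaGammaH (Υ δ : ℝ) (u : ℤ → ℂ) : ℤ → ℂ :=
  fun k => (alphaSymb Υ δ k : ℂ) * u k + (gammaSymb Υ δ k : ℂ) * hilb u k

/-- `(I + ΥΛ) F_ξξ + (β/4) Λ F_ξξξξ + δ Λ F_ξξξ + Λ F`. -/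
def linearPart (Υ δ β : ℝ) (F : ℤ → ℂ) : ℤ → ℂ :=
  (dxi (dxi F) + (Υ : ℂ) • lam (dxi (dxi F)))
    + ((β / 4 : ℝ) : ℂ) • lam (dxi (dxi (dxi (dxi F))))
    + (δ : ℂ) • lam (dxi (dxi (dxi F)))
    + lam F

/-- The quadratic nonlinearity
`½ Λ(F_ξ² - (ΛF)²) - [Λ, F_ξ] F_ξ + F_ξξ ΛF + [Λ, F] 𝒯F - F_ξ ℋ𝒯F
  + (β/4) ([Λ, F] 𝒯F_ξξξξ - F_ξ Λ𝒯F_ξξξ) + δ ([Λ, F] 𝒯F_ξξξ - F_ξ Λ𝒯F_ξξ)`. -/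
def nonlinearPart (Υ δ β : ℝ) (F : ℤ → ℂ) : ℤ → ℂ :=
  (1 / 2 : ℂ) • lam (prod (dxi F) (dxi F) - prod (lam F) (lam F))
    - commLam (dxi F) (dxi F)
    + prod (dxi (dxi F)) (lam F)
    + commLam F (tee Υ F)
    - prod (dxi F) (hilb (tee Υ F))
    + ((β / 4 : ℝ) : ℂ) •
        (commLam F (tee Υ (dxi (dxi (dxi (dxi F)))))
          - prod (dxi F) (lam (tee Υ (dxi (dxi (dxi F))))))
    + (δ : ℂ) •
        (commLam F (tee Υ (dxi (dxi (dxi F))))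
          - prod (dxi F) (lam (tee Υ (dxi (dxi F)))))

/-- The right-hand side of the second unidirectional model
`F_τ = (1/ε) (α + γℋ) [linear part] - (α + γℋ) [nonlinear part]`. -/
def modelRHS (ε Υ δ β : ℝ) (F : ℤ → ℂ) : ℤ → ℂ :=
  ((1 / ε : ℝ) : ℂ) • alphaGammaH Υ δ (linearPart Υ δ β F)
    - alphaGammaH Υ δ (nonlinearPart Υ δ β F)

/-- `F ∈ C([0,∞); H³)` is a global solution of the second unidirectional model with initial
datum `F₀`. The equation is an identity of periodic distributions at every time `τ ≥ 0`
(one-sided derivative at `τ = 0`), that is, an identity of all Fourier coefficients. -/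
structure IsGlobalSolution (ε Υ δ β : ℝ) (F₀ : L2Torus) (F : ℝ → L2Torus) : Prop where
  continuous : ContinuousInSobolev 3 F
  initial : F 0 = F₀
  equation : ∀ τ : ℝ, 0 ≤ τ → ∀ k : ℤ,
    HasDerivWithinAt (fun σ => coeff (F σ) k) (modelRHS ε Υ δ β (coeff (F τ)) k) (Set.Ici 0) τ

end Hydroelastic

end

/-! Put x_k = (1+k²)^{3/2} F̂(k). The H³ norm becomes the ℓ² norm, and the equation becomes a system
x_k' = a_k x_k + T_k(x). The symbol of α + γℋ is O(|k|⁻³) (`norm_projSymb_mul_le`) and the bracket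
it acts on has order five through the β-term, so Re a_k ≤ -c k²/ε (`re_symbol_le`).

The nonlinearity is a sum of bilinear kernels. Since commutators move a derivative onto F,
Cauchy–Schwarz gives |T_k(x) - T_k(y)| ≤ C|k|(‖x‖+‖y‖)‖x-y‖, with C independent of ε
(`quadBounded_nonlinearPart`, `exists_isParabolicSystem`). This bound is only uniform in k after
division by |k|, but Duhamel integration gains k⁻² and leaves |k|⁻¹, which is square summable. Hence
the Duhamel term is a locally Lipschitz quadratic map on families with ∑ sup_t |v_k|² < ∞, and a
contraction yields global solutions when (Cε/c)‖x₀‖ is small (`exists_solution`).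

Uniqueness needs no smallness: with the weight e^{-μt} the same estimate has a constant that tends
to 0 as μ → ∞ (`unique_solution`). Real data give real solutions because complex conjugation
preserves the equation and solutions are unique. -/

noncomputable section

namespace Hydroelastic

/-! ### Square-summable families -/

section SquareSummable

variable {E : Type*} [NormedAddCommGroup E]

lemma memlp_two {f : ℤ → E} (hf : Summable fun k => ‖f k‖ ^ 2) :
    Memℓp (E := fun _ : ℤ => E) f 2 := by
  refine memℓp_gen ?_
  simpa using hf

lemma summable_sq (x : lp (fun _ : ℤ => E) 2) : Summable fun k => ‖x k‖ ^ 2 := by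
  simpa using (lp.memℓp x).summable (by simp)

lemma norm_sq_eq_tsum (x : lp (fun _ : ℤ => E) 2) : ‖x‖ ^ 2 = ∑' k, ‖x k‖ ^ 2 := by
  simpa using lp.norm_rpow_eq_tsum (p := 2) (by simp) x

lemma memlp_of_le {f : ℤ → E} {r : ℤ → ℝ} (hr : Summable fun k => r k ^ 2)
    (h : ∀ k, ‖f k‖ ≤ r k) : Memℓp (E := fun _ : ℤ => E) f 2 :=
  memlp_two (Summable.of_nonneg_of_le (fun _ => by positivity)
    (fun k => pow_le_pow_left₀ (norm_nonneg _) (h k) 2) hr)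

lemma norm_sq_le_tsum (x : lp (fun _ : ℤ => E) 2) {r : ℤ → ℝ} (hr : Summable fun k => r k ^ 2)
    (h : ∀ k, ‖x k‖ ≤ r k) : ‖x‖ ^ 2 ≤ ∑' k, r k ^ 2 := by
  rw [norm_sq_eq_tsum]
  exact (summable_sq x).tsum_le_tsum
    (fun k => pow_le_pow_left₀ (norm_nonneg _) (h k) 2) hr

end SquareSummable

/-- Square-summable complex sequences indexed by `ℤ`. -/
abbrev Seq : Type := lp (fun _ : ℤ => ℂ) 2

/-- The sequence `j ↦ y (k - j)`. -/
def reflect (k : ℤ) (y : Seq) : Seq :=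
  ⟨fun j => y (k - j), memlp_two (((Equiv.subLeft k).summable_iff).2 (summable_sq y))⟩

lemma norm_reflect (k : ℤ) (y : Seq) : ‖reflect k y‖ = ‖y‖ := by
  have h : ‖reflect k y‖ ^ 2 = ‖y‖ ^ 2 := by
    rw [norm_sq_eq_tsum, norm_sq_eq_tsum]
    exact (Equiv.subLeft k).tsum_eq (fun j => ‖y j‖ ^ 2)
  exact (pow_left_inj₀ (norm_nonneg _) (norm_nonneg _) two_ne_zero).1 h

/-- Cauchy–Schwarz for x and the reflection of y. The bound is uniform in k, not square summable in
k; the parabolic gain compensates for this later. -/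
lemma summable_and_tsum_conv_le (x y : Seq) (k : ℤ) :
    (Summable fun j => ‖x j‖ * ‖y (k - j)‖) ∧ ∑' j, ‖x j‖ * ‖y (k - j)‖ ≤ ‖x‖ * ‖y‖ := by
  have hpq : (2 : ENNReal).toReal.HolderConjugate (2 : ENNReal).toReal := by
    simpa using Real.HolderConjugate.two_two
  have h1 := lp.summable_mul hpq x (reflect k y)
  have h2 := lp.tsum_mul_le_mul_norm' hpq x (reflect k y)
  rw [norm_reflect] at h2
  exact ⟨h1, h2⟩

/-! ### Sobolev weights -/

/-- The weight `(1 + k²)^{1/2}`. -/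
def jap (k : ℤ) : ℝ := Real.sqrt (1 + (k : ℝ) ^ 2)

lemma jap_sq (k : ℤ) : jap k ^ 2 = 1 + (k : ℝ) ^ 2 := Real.sq_sqrt (by positivity)

lemma one_le_jap (k : ℤ) : 1 ≤ jap k := by
  rw [jap, Real.one_le_sqrt]
  nlinarith [sq_nonneg (k : ℝ)]

lemma jap_pos (k : ℤ) : 0 < jap k := one_pos.trans_le (one_le_jap k)

lemma abs_le_jap (k : ℤ) : |(k : ℝ)| ≤ jap k := by
  rw [jap]
  exact Real.le_sqrt_of_sq_le (by rw [sq_abs]; linarith)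

lemma one_le_abs {k : ℤ} (hk : k ≠ 0) : 1 ≤ |(k : ℝ)| := by
  exact_mod_cast Int.one_le_abs hk

lemma jap_le_two_mul_abs {k : ℤ} (hk : k ≠ 0) : jap k ≤ 2 * |(k : ℝ)| := by
  have h := one_le_abs hk
  refine Real.sqrt_le_iff.2 ⟨by positivity, ?_⟩
  nlinarith [sq_abs (k : ℝ)]

/-- A multiplicative triangle inequality: one excess derivative on the factor at k - j is traded for
one on the other factor and a power of the output frequency. -/
lemma jap_sub_le {k : ℤ} (hk : k ≠ 0) (j : ℤ) : jap (k - j) ≤ 4 * |(k : ℝ)| * jap j := by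
  have h := one_le_abs hk
  have hj := jap_pos j
  refine Real.sqrt_le_iff.2 ⟨by positivity, ?_⟩
  rw [mul_pow, jap_sq]
  push_cast
  have h3 : (4 * |(k : ℝ)|) ^ 2 = 16 * (k : ℝ) ^ 2 := by rw [mul_pow, sq_abs]; norm_num
  have h4 : 1 ≤ (k : ℝ) ^ 2 := by rw [← sq_abs]; nlinarith
  rw [h3]
  nlinarith [sq_nonneg ((k : ℝ) + j), mul_nonneg (sub_nonneg.2 h4) (sq_nonneg (j : ℝ))]

/-- The left side is the kernel of [Λ, f]: the commutator puts its derivative on f. -/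
lemma abs_sub_abs_le (k j : ℤ) : |(|(k : ℝ)| - |((k - j : ℤ) : ℝ)|)| ≤ jap j := by
  refine (abs_abs_sub_abs_le _ _).trans ?_
  push_cast
  rw [sub_sub_cancel]
  exact abs_le_jap j

/-- The Fourier coefficients whose weighted coefficients `(1 + k²)^{3/2} u_k` are `x`. -/
def unweight (x : Seq) : ℤ → ℂ := fun k => x k / ((jap k ^ 3 : ℝ) : ℂ)

lemma norm_unweight (x : Seq) (k : ℤ) : ‖unweight x k‖ = ‖x k‖ / jap k ^ 3 := by
  rw [unweight, norm_div, Complex.norm_real, Real.norm_of_nonneg (pow_nonneg (jap_pos k).le 3)]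

lemma norm_mul_unweight_le {κ : ℂ} {C : ℝ} {k j : ℤ}
    (h : ‖κ‖ ≤ C * (jap j ^ 3 * jap (k - j) ^ 3)) (x y : Seq) :
    ‖κ * (unweight x j * unweight y (k - j))‖ ≤ C * (‖x j‖ * ‖y (k - j)‖) := by
  have h1 := jap_pos j
  have h2 := jap_pos (k - j)
  rw [norm_mul, norm_mul, norm_unweight, norm_unweight, div_mul_div_comm, mul_div_assoc',
    div_le_iff₀ (by positivity)]
  calc _ ≤ C * (jap j ^ 3 * jap (k - j) ^ 3) * (‖x j‖ * ‖y (k - j)‖) := by gcongr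
    _ = _ := by ring

lemma summable_kernel {κ : ℤ → ℂ} {C : ℝ} {k : ℤ}
    (h : ∀ j, ‖κ j‖ ≤ C * (jap j ^ 3 * jap (k - j) ^ 3)) (x y : Seq) :
    Summable fun j => κ j * (unweight x j * unweight y (k - j)) :=
  Summable.of_norm_bounded ((summable_and_tsum_conv_le x y k).1.mul_left C)
    (fun j => norm_mul_unweight_le (h j) x y)

lemma norm_tsum_kernel_le {κ : ℤ → ℂ} {C : ℝ} (hC : 0 ≤ C) {k : ℤ}
    (h : ∀ j, ‖κ j‖ ≤ C * (jap j ^ 3 * jap (k - j) ^ 3)) (x y : Seq) :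
    ‖∑' j, κ j * (unweight x j * unweight y (k - j))‖ ≤ C * (‖x‖ * ‖y‖) := by
  obtain ⟨h1, h2⟩ := summable_and_tsum_conv_le x y k
  refine (tsum_of_norm_bounded (h1.mul_left C).hasSum
    (fun j => norm_mul_unweight_le (h j) x y)).trans ?_
  rw [tsum_mul_left]
  gcongr

/-! ### Quadratic expressions -/

/-- `N` is a quadratic expression on `H³`, given by a kernel whose nonzero modes are bounded by
`C |k|` in terms of the `H³` weights. -/
def QuadBounded (N : (ℤ → ℂ) → ℤ → ℂ) : Prop :=
  ∃ C : ℝ, 0 ≤ C ∧ ∃ K : ℤ → ℤ → ℂ, ∀ k : ℤ, k ≠ 0 →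
    (∀ j, ‖K k j‖ ≤ C * |(k : ℝ)| * (jap j ^ 3 * jap (k - j) ^ 3)) ∧
    ∀ x : Seq, N (unweight x) k = ∑' j, K k j * (unweight x j * unweight x (k - j))

namespace QuadBounded

variable {N M : (ℤ → ℂ) → ℤ → ℂ}

lemma add (hN : QuadBounded N) (hM : QuadBounded M) : QuadBounded fun u => N u + M u := by
  obtain ⟨C, hC, K, hK⟩ := hN
  obtain ⟨D, hD, L, hL⟩ := hM
  refine ⟨C + D, by positivity, fun k j => K k j + L k j, fun k hk => ⟨fun j => ?_, fun x => ?_⟩⟩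
  · refine (norm_add_le _ _).trans ((add_le_add ((hK k hk).1 j) ((hL k hk).1 j)).trans_eq ?_)
    ring
  · change N (unweight x) k + M (unweight x) k = _
    rw [(hK k hk).2 x, (hL k hk).2 x,
      ← (summable_kernel (hK k hk).1 x x).tsum_add (summable_kernel (hL k hk).1 x x)]
    exact tsum_congr fun j => by ring

lemma smul (c : ℂ) (hN : QuadBounded N) : QuadBounded fun u => c • N u := by
  obtain ⟨C, hC, K, hK⟩ := hN
  refine ⟨‖c‖ * C, by positivity, fun k j => c * K k j, fun k hk => ⟨fun j => ?_, fun x => ?_⟩⟩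
  · rw [norm_mul, mul_assoc, mul_assoc, ← mul_assoc C]
    exact mul_le_mul_of_nonneg_left ((hK k hk).1 j) (norm_nonneg _)
  · change c * N (unweight x) k = _
    rw [(hK k hk).2 x, ← tsum_mul_left]
    exact tsum_congr fun j => by ring

lemma sub (hN : QuadBounded N) (hM : QuadBounded M) : QuadBounded fun u => N u - M u := by
  have h := hN.add (hM.smul (-1))
  simpa [sub_eq_add_neg] using h

/-- The estimate that makes a quadratic expression locally Lipschitz on `H³`. -/
lemma exists_lipschitz (hN : QuadBounded N) : ∃ C : ℝ, 0 ≤ C ∧ ∀ k : ℤ, k ≠ 0 →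
    N (unweight 0) k = 0 ∧ ∀ x y : Seq, ‖N (unweight x) k - N (unweight y) k‖ ≤
      C * |(k : ℝ)| * ((‖x‖ + ‖y‖) * ‖x - y‖) := by
  obtain ⟨C, hC, K, hK⟩ := hN
  refine ⟨C, hC, fun k hk => ⟨?_, fun x y => ?_⟩⟩
  · rw [(hK k hk).2]
    simp [unweight]
  · have hb := (hK k hk).1
    have hCk : 0 ≤ C * |(k : ℝ)| := by positivity
    -- Polarization of the bilinear form: B(x,x) - B(y,y) = B(x,x-y) + B(x-y,y).
    have key : N (unweight x) k - N (unweight y) k =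
        (∑' j, K k j * (unweight x j * unweight (x - y) (k - j))) +
          ∑' j, K k j * (unweight (x - y) j * unweight y (k - j)) := by
      rw [(hK k hk).2 x, (hK k hk).2 y,
        ← (summable_kernel hb x x).tsum_sub (summable_kernel hb y y),
        ← (summable_kernel hb x (x - y)).tsum_add (summable_kernel hb (x - y) y)]
      refine tsum_congr fun j => ?_
      simp only [unweight, lp.coeFn_sub, Pi.sub_apply]
      ring
    rw [key]
    refine (norm_add_le _ _).trans ((add_le_add (norm_tsum_kernel_le hCk hb x (x - y))
      (norm_tsum_kernel_le hCk hb (x - y) y)).trans_eq ?_)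
    ring

end QuadBounded

/-! ### Fourier multipliers and their bilinear kernels -/

/-- The Fourier multiplier with symbol `m`. -/
def mult (m : ℤ → ℂ) (u : ℤ → ℂ) : ℤ → ℂ := fun k => m k * u k

/-- The symbol `m` has order at most `p`. -/
def HasOrder (m : ℤ → ℂ) (p : ℕ) : Prop := ∃ A : ℝ, 0 ≤ A ∧ ∀ k, ‖m k‖ ≤ A * jap k ^ p

lemma HasOrder.mono {m : ℤ → ℂ} {p q : ℕ} (h : HasOrder m p) (hpq : p ≤ q) : HasOrder m q := by
  obtain ⟨A, hA, hm⟩ := h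
  exact ⟨A, hA, fun k => (hm k).trans
    (mul_le_mul_of_nonneg_left (pow_le_pow_right₀ (one_le_jap k) hpq) hA)⟩

lemma HasOrder.mul {m n : ℤ → ℂ} {p q : ℕ} (hm : HasOrder m p) (hn : HasOrder n q) :
    HasOrder (fun k => m k * n k) (p + q) := by
  obtain ⟨A, hA, hm⟩ := hm
  obtain ⟨B, hB, hn⟩ := hn
  refine ⟨A * B, by positivity, fun k => ?_⟩
  have := jap_pos k
  rw [norm_mul, pow_add]
  calc _ ≤ (A * jap k ^ p) * (B * jap k ^ q) :=
        mul_le_mul (hm k) (hn k) (norm_nonneg _) (by positivity)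
    _ = _ := by ring

lemma prod_mult (m n : ℤ → ℂ) (u : ℤ → ℂ) (k : ℤ) :
    prod (mult m u) (mult n u) k = ∑' j, (m j * n (k - j)) * (u j * u (k - j)) :=
  tsum_congr fun j => by simp only [mult]; ring

/-- The second factor exceeds the H³ weight by one derivative and the first has one to spare;
`jap_sub_le` makes the exchange at the cost of |k|. -/
lemma QuadBounded.prod {m n : ℤ → ℂ} (hm : HasOrder m 2) (hn : HasOrder n 4) :
    QuadBounded fun u => Hydroelastic.prod (mult m u) (mult n u) := by
  obtain ⟨A, hA, hm⟩ := hm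
  obtain ⟨B, hB, hn⟩ := hn
  refine ⟨4 * (A * B), by positivity, fun k j => m j * n (k - j),
    fun k hk => ⟨fun j => ?_, fun x => prod_mult m n _ k⟩⟩
  have h1 := jap_pos j
  have h2 := jap_pos (k - j)
  rw [norm_mul]
  calc _ ≤ (A * jap j ^ 2) * (B * jap (k - j) ^ 4) :=
        mul_le_mul (hm j) (hn _) (norm_nonneg _) (by positivity)
    _ = A * B * jap j ^ 2 * jap (k - j) ^ 3 * jap (k - j) := by ring
    _ ≤ A * B * jap j ^ 2 * jap (k - j) ^ 3 * (4 * |(k : ℝ)| * jap j) := by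
        gcongr; exact jap_sub_le hk j
    _ = _ := by ring

/-- Here the outer Λ itself is the permitted factor |k|. -/
lemma QuadBounded.lam_prod {m n : ℤ → ℂ} (hm : HasOrder m 3) (hn : HasOrder n 3) :
    QuadBounded fun u => lam (Hydroelastic.prod (mult m u) (mult n u)) := by
  obtain ⟨A, hA, hm⟩ := hm
  obtain ⟨B, hB, hn⟩ := hn
  refine ⟨A * B, by positivity, fun k j => ((|(k : ℝ)| : ℝ) : ℂ) * (m j * n (k - j)),
    fun k hk => ⟨fun j => ?_, fun x => ?_⟩⟩
  · have h1 := jap_pos j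
    have h2 := jap_pos (k - j)
    rw [norm_mul, norm_mul, Complex.norm_real, Real.norm_of_nonneg (abs_nonneg _)]
    calc _ ≤ |(k : ℝ)| * ((A * jap j ^ 3) * (B * jap (k - j) ^ 3)) := by
          gcongr; exacts [hm j, hn _]
      _ = _ := by ring
  · change ((|(k : ℝ)| : ℝ) : ℂ) * Hydroelastic.prod _ _ k = _
    rw [prod_mult, ← tsum_mul_left]
    exact tsum_congr fun j => by ring

/-- By `abs_sub_abs_le` the commutator raises the first order from 1 to 2, which is the balance of
`QuadBounded.prod`. -/
lemma QuadBounded.commLam {m n : ℤ → ℂ} (hm : HasOrder m 1) (hn : HasOrder n 4) :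
    QuadBounded fun u => Hydroelastic.commLam (mult m u) (mult n u) := by
  obtain ⟨A, hA, hm⟩ := hm
  obtain ⟨B, hB, hn⟩ := hn
  have hmn (k j : ℤ) : ‖m j * n (k - j)‖ ≤ A * B * (jap j * jap (k - j) ^ 4) := by
    have h1 := jap_pos j
    have h2 := jap_pos (k - j)
    rw [norm_mul]
    calc _ ≤ (A * jap j ^ 1) * (B * jap (k - j) ^ 4) :=
          mul_le_mul (hm j) (hn _) (norm_nonneg _) (by positivity)
      _ = _ := by ring
  refine ⟨4 * (A * B), by positivity,
    fun k j => ((|(k : ℝ)| - |((k - j : ℤ) : ℝ)| : ℝ) : ℂ) * (m j * n (k - j)),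
    fun k hk => ⟨fun j => ?_, fun x => ?_⟩⟩
  · have h1 := jap_pos j
    have h2 := jap_pos (k - j)
    rw [norm_mul, Complex.norm_real, Real.norm_eq_abs]
    calc _ ≤ jap j * (A * B * (jap j * jap (k - j) ^ 4)) :=
          mul_le_mul (abs_sub_abs_le k j) (hmn k j) (norm_nonneg _) h1.le
      _ = A * B * jap j ^ 2 * jap (k - j) ^ 3 * jap (k - j) := by ring
      _ ≤ A * B * jap j ^ 2 * jap (k - j) ^ 3 * (4 * |(k : ℝ)| * jap j) := by
          gcongr; exact jap_sub_le hk j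
      _ = _ := by ring
  -- The two halves of the commutator must converge separately before they are merged. Only
  -- summability in j matters here, so the constants may grow faster in k.
  · have s1 : Summable fun j => (m j * n (k - j)) * (unweight x j * unweight x (k - j)) := by
      refine summable_kernel (C := A * B * (4 * |(k : ℝ)|)) (fun j => (hmn k j).trans ?_) x x
      have h1 := jap_pos j
      have h2 := jap_pos (k - j)
      have h3 := one_le_jap j
      calc _ = A * B * jap j * jap (k - j) ^ 3 * jap (k - j) := by ring
        _ ≤ A * B * jap j ^ 2 * jap (k - j) ^ 3 * (4 * |(k : ℝ)| * jap j) := by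
            gcongr
            · nlinarith
            · exact jap_sub_le hk j
        _ = _ := by ring
    have s2 : Summable fun j => (((|((k - j : ℤ) : ℝ)| : ℝ) : ℂ) * (m j * n (k - j))) *
        (unweight x j * unweight x (k - j)) := by
      refine summable_kernel (C := A * B * (4 * |(k : ℝ)|) ^ 2) (fun j => ?_) x x
      have h1 := jap_pos j
      have h2 := jap_pos (k - j)
      rw [norm_mul, Complex.norm_real, Real.norm_of_nonneg (abs_nonneg _)]
      calc _ ≤ jap (k - j) * (A * B * (jap j * jap (k - j) ^ 4)) :=
            mul_le_mul (abs_le_jap _) (hmn k j) (norm_nonneg _) h2.le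
        _ = A * B * jap j * jap (k - j) ^ 3 * jap (k - j) ^ 2 := by ring
        _ ≤ A * B * jap j * jap (k - j) ^ 3 * (4 * |(k : ℝ)| * jap j) ^ 2 := by
            gcongr; exact jap_sub_le hk j
        _ = _ := by ring
    have e : lam (mult n (unweight x)) =
        mult (fun k => ((|(k : ℝ)| : ℝ) : ℂ) * n k) (unweight x) := by
      ext k; simp only [lam, mult]; ring
    change ((|(k : ℝ)| : ℝ) : ℂ) * Hydroelastic.prod _ _ k -
      Hydroelastic.prod _ (lam (mult n (unweight x))) k = _
    rw [e, prod_mult, prod_mult, ← tsum_mul_left,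
      ← (s1.mul_left _).tsum_sub (by
        refine s2.congr fun j => ?_
        ring)]
    refine tsum_congr fun j => ?_
    push_cast
    ring

/-! ### Scalar linear equations -/

/-- Estimate for `w' = a w + g`, `w 0 = 0`, with exponentially bounded forcing. -/
lemma norm_le_of_linear_ode {a : ℂ} {w g : ℝ → ℂ} {M μ T : ℝ}
    (hμ : 0 < μ - a.re) (hw : ∀ t, 0 ≤ t → HasDerivWithinAt w (a * w t + g t) (Set.Ici 0) t)
    (h0 : w 0 = 0) (hM : 0 ≤ M) (hg : ∀ t, 0 ≤ t → t ≤ T → ‖g t‖ ≤ M * Real.exp (μ * t))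
    {t : ℝ} (ht : 0 ≤ t) (htT : t ≤ T) : ‖w t‖ ≤ M * Real.exp (μ * t) / (μ - a.re) := by
  have hv : ∀ s : ℝ, 0 ≤ s → HasDerivWithinAt (fun s : ℝ => Complex.exp (-a * s) * w s)
      (Complex.exp (-a * s) * g s) (Set.Ici 0) s := by
    intro s hs
    have h1 : HasDerivAt (fun s : ℝ => Complex.exp (-a * s)) (Complex.exp (-a * s) * (-a)) s := by
      have h2 : HasDerivAt (fun s : ℝ => -a * (s : ℂ)) (-a) s := by
        simpa using (Complex.ofRealCLM.hasDerivAt (x := s)).const_mul (-a)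
      exact h2.cexp
    exact (h1.hasDerivWithinAt.mul (hw s hs)).congr_deriv (by ring)
  have hB : ∀ s : ℝ, HasDerivAt (fun s : ℝ => M * Real.exp ((μ - a.re) * s) / (μ - a.re))
      (M * Real.exp ((μ - a.re) * s)) s := by
    intro s
    have h2 : HasDerivAt (fun s : ℝ => (μ - a.re) * s) (μ - a.re) s := by
      simpa using (hasDerivAt_id s).const_mul (μ - a.re)
    exact ((h2.exp.const_mul M).div_const _).congr_deriv (by field_simp)
  have hexp (s : ℝ) : ‖Complex.exp (-a * s)‖ = Real.exp (-a.re * s) := by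
    rw [Complex.norm_exp]; simp
  -- With the integrating factor, the norm of the derivative is at most the derivative of the
  -- explicit majorant. This comparison requires no integrability of g.
  have key := image_norm_le_of_norm_deriv_right_le_deriv_boundary
    (f := fun s : ℝ => Complex.exp (-a * s) * w s) (a := 0) (b := T)
    (fun s hs => ((hv s hs.1).continuousWithinAt).mono Set.Icc_subset_Ici_self)
    (fun s hs => (hv s hs.1).mono (Set.Ici_subset_Ici.2 hs.1))
    (by simp only [h0, mul_zero, norm_zero]; positivity) hB
    (fun s hs => by
      rw [norm_mul, hexp]
      calc _ ≤ Real.exp (-a.re * s) * (M * Real.exp (μ * s)) := by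
            exact mul_le_mul_of_nonneg_left (hg s hs.1 hs.2.le) (Real.exp_pos _).le
        _ = M * (Real.exp (-a.re * s) * Real.exp (μ * s)) := by ring
        _ = _ := by rw [← Real.exp_add]; ring_nf) ⟨ht, htT⟩
  rw [norm_mul, hexp] at key
  have h3 : Real.exp (a.re * t) * Real.exp (-a.re * t) = 1 := by
    rw [← Real.exp_add]; simp
  calc ‖w t‖ = Real.exp (a.re * t) * (Real.exp (-a.re * t) * ‖w t‖) := by
        rw [← mul_assoc, h3, one_mul]
    _ ≤ Real.exp (a.re * t) * (M * Real.exp ((μ - a.re) * t) / (μ - a.re)) := by gcongr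
    _ = M * (Real.exp (a.re * t) * Real.exp ((μ - a.re) * t)) / (μ - a.re) := by ring
    _ = _ := by rw [← Real.exp_add]; ring_nf

/-- The solution of `w' = a w + g` with `w 0 = 0`. -/
def duhamel (a : ℂ) (g : ℝ → ℂ) (t : ℝ) : ℂ :=
  Complex.exp (a * t) * ∫ s in (0 : ℝ)..t, Complex.exp (-a * s) * g s

lemma hasDerivAt_cexp_mul (a : ℂ) (t : ℝ) :
    HasDerivAt (fun t : ℝ => Complex.exp (a * t)) (a * Complex.exp (a * t)) t := by
  have h2 : HasDerivAt (fun s : ℝ => a * (s : ℂ)) a t := by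
    simpa using (Complex.ofRealCLM.hasDerivAt (x := t)).const_mul a
  exact h2.cexp.congr_deriv (by ring)

lemma hasDerivAt_duhamel (a : ℂ) {g : ℝ → ℂ} (hg : Continuous g) (t : ℝ) :
    HasDerivAt (duhamel a g) (a * duhamel a g t + g t) t := by
  have hc : Continuous fun s : ℝ => Complex.exp (-a * s) * g s := by fun_prop
  have h1 := intervalIntegral.integral_hasDerivAt_right (hc.intervalIntegrable 0 t)
    (hc.stronglyMeasurableAtFilter _ _) hc.continuousAt
  refine ((hasDerivAt_cexp_mul a t).mul h1).congr_deriv ?_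
  have h3 : Complex.exp (a * t) * Complex.exp (-a * t) = 1 := by
    rw [← Complex.exp_add]; simp
  rw [duhamel, ← mul_assoc (Complex.exp (a * t)), h3]
  ring

lemma duhamel_zero (a : ℂ) (g : ℝ → ℂ) : duhamel a g 0 = 0 := by simp [duhamel]

lemma duhamel_sub (a : ℂ) {g h : ℝ → ℂ} (hg : Continuous g) (hh : Continuous h) (t : ℝ) :
    duhamel a g t - duhamel a h t = duhamel a (fun s => g s - h s) t := by
  have h1 : Continuous fun s : ℝ => Complex.exp (-a * s) * g s := by fun_prop
  have h2 : Continuous fun s : ℝ => Complex.exp (-a * s) * h s := by fun_prop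
  rw [duhamel, duhamel, duhamel, ← mul_sub,
    ← intervalIntegral.integral_sub (h1.intervalIntegrable _ _) (h2.intervalIntegrable _ _)]
  simp only [mul_sub]

lemma norm_duhamel_le {a : ℂ} {g : ℝ → ℂ} {M : ℝ} (ha : a.re < 0) (hg : Continuous g)
    (hM : ∀ t, ‖g t‖ ≤ M) {t : ℝ} (ht : 0 ≤ t) : ‖duhamel a g t‖ ≤ M / (-a.re) := by
  have h := norm_le_of_linear_ode (a := a) (μ := 0) (M := M) (T := t) (by linarith)
    (fun s _ => (hasDerivAt_duhamel a hg s).hasDerivWithinAt) (duhamel_zero a g)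
    ((norm_nonneg _).trans (hM 0)) (fun s _ _ => by simpa using hM s) ht le_rfl
  simpa using h

/-! ### A fixed point theorem for quadratic perturbations -/

/-- Contraction on the ball of radius 2‖x₀‖, where the Lipschitz constant is at most 4K‖x₀‖ ≤ 1/2.
-/
lemma exists_eq_add_quadratic {X : Type*} [NormedAddCommGroup X] [CompleteSpace X]
    {Q : X → X} {K : ℝ} (hK : 0 ≤ K) (hQ0 : Q 0 = 0)
    (hQ : ∀ x y, ‖Q x - Q y‖ ≤ K * ((‖x‖ + ‖y‖) * ‖x - y‖)) {x₀ : X} (h : 8 * (K * ‖x₀‖) ≤ 1) :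
    ∃ x, x = x₀ + Q x := by
  have hn := norm_nonneg x₀
  have hmaps : Set.MapsTo (fun x => x₀ + Q x) (Metric.closedBall 0 (2 * ‖x₀‖))
      (Metric.closedBall 0 (2 * ‖x₀‖)) := by
    intro x hx
    rw [mem_closedBall_zero_iff] at hx ⊢
    have h1 := hQ x 0
    simp only [hQ0, sub_zero, norm_zero, add_zero] at h1
    have h2 : K * (‖x‖ * ‖x‖) ≤ K * (2 * ‖x₀‖ * (2 * ‖x₀‖)) := by gcongr
    have h3 := norm_add_le x₀ (Q x)
    nlinarith
  have hlip : ContractingWith (1 / 2) (hmaps.restrict (fun x => x₀ + Q x) _ _) := by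
    refine ⟨by norm_num, LipschitzWith.of_dist_le_mul fun x y => ?_⟩
    have hx := mem_closedBall_zero_iff.1 x.2
    have hy := mem_closedBall_zero_iff.1 y.2
    rw [Subtype.dist_eq, Subtype.dist_eq, dist_eq_norm, dist_eq_norm]
    simp only [Set.MapsTo.val_restrict_apply, add_sub_add_left_eq_sub]
    refine (hQ _ _).trans ?_
    rw [← mul_assoc]
    refine mul_le_mul_of_nonneg_right ?_ (norm_nonneg _)
    have : K * (‖(x : X)‖ + ‖(y : X)‖) ≤ K * (2 * ‖x₀‖ + 2 * ‖x₀‖) := by gcongr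
    push_cast
    linarith
  obtain ⟨x, -, hx, -⟩ := hlip.exists_fixedPoint' Metric.isClosed_closedBall.isComplete
    hmaps (x := 0) (by simp) (edist_ne_top _ _)
  exact ⟨x, hx.symm⟩

/-! ### Square-summable families of bounded continuous functions -/

/-- Families `(v_k)` of bounded continuous functions of time with `∑ sup_t |v_k(t)|² < ∞`. -/
abbrev Path : Type := lp (fun _ : ℤ => BoundedContinuousFunction ℝ ℂ) 2

/-- The value of a path at time `t`. -/
def Path.eval (v : Path) (t : ℝ) : Seq :=
  ⟨fun k => v k t, memlp_of_le (summable_sq v) fun k => (v k).norm_coe_le_norm t⟩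

lemma Path.norm_eval_le (v : Path) (t : ℝ) : ‖v.eval t‖ ≤ ‖v‖ := by
  refine (pow_le_pow_iff_left₀ (norm_nonneg _) (norm_nonneg _) two_ne_zero).1 ?_
  rw [norm_sq_eq_tsum v]
  exact norm_sq_le_tsum _ (summable_sq v) fun k => (v k).norm_coe_le_norm t

lemma Path.norm_eval_sub_le (v w : Path) (t : ℝ) : ‖v.eval t - w.eval t‖ ≤ ‖v - w‖ :=
  (v - w).norm_eval_le t

/-- Having the supremum in time inside the sum supplies the dominating series 4 ∑ ‖v_k‖². -/
lemma Path.continuous_eval (v : Path) : Continuous v.eval := by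
  refine continuous_iff_continuousAt.2 fun t => ?_
  refine tendsto_iff_norm_sub_tendsto_zero.2 ?_
  have h : Tendsto (fun s => ∑' k, ‖v k s - v k t‖ ^ 2) (𝓝 t) (𝓝 (∑' _ : ℤ, (0 : ℝ))) := by
    refine tendsto_tsum_of_dominated_convergence ((summable_sq v).mul_left 4) (fun k => ?_)
      (Eventually.of_forall fun s k => ?_)
    · have hc : Continuous fun s => ‖v k s - v k t‖ ^ 2 := by fun_prop
      simpa using hc.tendsto t
    · rw [norm_pow, norm_norm]
      have h1 := (v k).norm_coe_le_norm s
      have h2 := (v k).norm_coe_le_norm t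
      have h3 := norm_sub_le (v k s) (v k t)
      calc _ ≤ (2 * ‖v k‖) ^ 2 := by gcongr; linarith
        _ = _ := by ring
  rw [tsum_zero] at h
  have h2 := h.sqrt
  rw [Real.sqrt_zero] at h2
  refine h2.congr fun s => ?_
  rw [Real.sqrt_eq_iff_mul_self_eq (tsum_nonneg fun _ => by positivity) (norm_nonneg _), ← sq,
    norm_sq_eq_tsum]
  rfl

/-! ### Parabolic systems with a quadratic nonlinearity -/

/-- Diagonal linear part with symbol `a`, dissipative of order two, and a nonlinearity `T` that
is quadratic and loses one derivative. -/
structure IsParabolicSystem (c C : ℝ) (a : ℤ → ℂ) (T : ℤ → Seq → ℂ) : Prop where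
  pos : 0 < c
  nonneg : 0 ≤ C
  re_le : ∀ k, (a k).re ≤ -(c * (k : ℝ) ^ 2)
  map_zero : ∀ k, T k 0 = 0
  lipschitz : ∀ k x y, ‖T k x - T k y‖ ≤ C * |(k : ℝ)| * ((‖x‖ + ‖y‖) * ‖x - y‖)

/-- `x` solves `x_k' = a_k x_k + T_k(x)` for `t ≥ 0`. -/
def SolvesSystem (a : ℤ → ℂ) (T : ℤ → Seq → ℂ) (x : ℝ → Seq) : Prop :=
  ∀ t : ℝ, 0 ≤ t → ∀ k : ℤ,
    HasDerivWithinAt (fun s => x s k) (a k * x t k + T k (x t)) (Set.Ici 0) t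

lemma summable_inv_abs_sq : Summable fun k : ℤ => (|(k : ℝ)|⁻¹) ^ 2 := by
  have h : Summable fun k : ℤ => 1 / (k : ℝ) ^ 2 :=
    Real.summable_one_div_int_pow.2 (by norm_num)
  exact h.congr fun k => by rw [inv_pow, sq_abs, one_div]

namespace IsParabolicSystem

variable {c C : ℝ} {a : ℤ → ℂ} {T : ℤ → Seq → ℂ}

lemma continuous_map (h : IsParabolicSystem c C a T) (k : ℤ) : Continuous (T k) := by
  refine continuous_iff_continuousAt.2 fun x => tendsto_iff_norm_sub_tendsto_zero.2 ?_
  have hc : Continuous fun y : Seq => C * |(k : ℝ)| * ((‖y‖ + ‖x‖) * ‖y - x‖) := by fun_prop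
  have h0 := hc.tendsto x
  simp only [sub_self, norm_zero, mul_zero] at h0
  exact squeeze_zero (fun _ => norm_nonneg _) (fun y => h.lipschitz k y x) h0

lemma map_zero_mode (h : IsParabolicSystem c C a T) (x : Seq) : T 0 x = 0 := by
  have := h.lipschitz 0 x 0
  rw [h.map_zero] at this
  simpa using this

/-- Forcing of size |k| divided by the dissipation c k² leaves |k|⁻¹. At k = 0 both sides vanish, by
the convention 0⁻¹ = 0. -/
lemma norm_duhamel_sub_le (h : IsParabolicSystem c C a T) (v w : Path) (k : ℤ) {t : ℝ}
    (ht : 0 ≤ t) :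
    ‖duhamel (a k) (fun s => T k (v.eval s)) t - duhamel (a k) (fun s => T k (w.eval s)) t‖ ≤
      C / c * ((‖v‖ + ‖w‖) * ‖v - w‖) * |(k : ℝ)|⁻¹ := by
  have hc := h.pos
  have hC := h.nonneg
  rcases eq_or_ne k 0 with rfl | hk
  · simp [h.map_zero_mode]
  have hk0 : 0 < |(k : ℝ)| := one_pos.trans_le (one_le_abs hk)
  have hre : c * |(k : ℝ)| ^ 2 ≤ -(a k).re := by rw [sq_abs]; linarith [h.re_le k]
  have hcv : Continuous fun s => T k (v.eval s) := (h.continuous_map k).comp v.continuous_eval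
  have hcw : Continuous fun s => T k (w.eval s) := (h.continuous_map k).comp w.continuous_eval
  have hpos : 0 < c * |(k : ℝ)| ^ 2 := by positivity
  rw [duhamel_sub _ hcv hcw]
  refine (norm_duhamel_le (M := C * |(k : ℝ)| * ((‖v‖ + ‖w‖) * ‖v - w‖)) (by linarith)
    (hcv.sub hcw) (fun s => (h.lipschitz k _ _).trans ?_) ht).trans ?_
  · have h1 := v.norm_eval_le s
    have h2 := w.norm_eval_le s
    have h3 := v.norm_eval_sub_le w s
    gcongr
  · calc _ ≤ C * |(k : ℝ)| * ((‖v‖ + ‖w‖) * ‖v - w‖) / (c * |(k : ℝ)| ^ 2) := by gcongr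
      _ = _ := by field_simp

lemma norm_duhamel_path_le (h : IsParabolicSystem c C a T) (v : Path) (k : ℤ) {t : ℝ}
    (ht : 0 ≤ t) :
    ‖duhamel (a k) (fun s => T k (v.eval s)) t‖ ≤ C / c * (‖v‖ * ‖v‖) * |(k : ℝ)|⁻¹ := by
  have h1 := h.norm_duhamel_sub_le v 0 k ht
  have h2 (s : ℝ) : T k (Path.eval 0 s) = 0 := h.map_zero k
  simpa [h2, duhamel] using h1

/-- The Duhamel term of a path, frozen at its initial value for negative times. -/
def duhamelPath (h : IsParabolicSystem c C a T) (v : Path) : Path :=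
  ⟨fun k => BoundedContinuousFunction.ofNormedAddCommGroup
      (fun t => duhamel (a k) (fun s => T k (v.eval s)) (max t 0))
      ((continuous_iff_continuousAt.2 fun t => (hasDerivAt_duhamel (a k)
        ((h.continuous_map k).comp v.continuous_eval) t).continuousAt).comp (by fun_prop))
      (C / c * (‖v‖ * ‖v‖) * |(k : ℝ)|⁻¹)
      (fun _ => h.norm_duhamel_path_le v k (le_max_right _ _)),
    memlp_of_le (r := fun k => C / c * (‖v‖ * ‖v‖) * |(k : ℝ)|⁻¹)
      (by simpa only [mul_pow] using summable_inv_abs_sq.mul_left _)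
      (fun k => BoundedContinuousFunction.norm_ofNormedAddCommGroup_le _
        (by have := h.pos; have := h.nonneg; positivity) _)⟩

lemma norm_duhamelPath_sub_le (h : IsParabolicSystem c C a T) (v w : Path) :
    ‖h.duhamelPath v - h.duhamelPath w‖ ≤
      (C / c * Real.sqrt (∑' k : ℤ, (|(k : ℝ)|⁻¹) ^ 2)) * ((‖v‖ + ‖w‖) * ‖v - w‖) := by
  have hc := h.pos
  have hC := h.nonneg
  refine (pow_le_pow_iff_left₀ (norm_nonneg _) (by positivity) two_ne_zero).1 ?_
  refine (norm_sq_le_tsum _ (r := fun k => C / c * ((‖v‖ + ‖w‖) * ‖v - w‖) * |(k : ℝ)|⁻¹)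
    (by simpa only [mul_pow] using summable_inv_abs_sq.mul_left _) fun k => ?_).trans_eq ?_
  · refine (BoundedContinuousFunction.norm_le (by positivity)).2 fun t => ?_
    exact h.norm_duhamel_sub_le v w k (le_max_right t 0)
  · simp only [mul_pow, tsum_mul_left]
    rw [Real.sq_sqrt (tsum_nonneg fun _ => by positivity)]
    ring

lemma norm_cexp_mul_le (h : IsParabolicSystem c C a T) (x₀ : Seq) (k : ℤ) (t : ℝ) :
    ‖Complex.exp (a k * (max t 0 : ℝ)) * x₀ k‖ ≤ ‖x₀ k‖ := by
  have h1 : (a k).re ≤ 0 := (h.re_le k).trans (by have := h.pos; simp; positivity)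
  rw [norm_mul, Complex.norm_exp]
  refine mul_le_of_le_one_left (norm_nonneg _) (Real.exp_le_one_iff.2 ?_)
  simpa using mul_nonpos_of_nonpos_of_nonneg h1 (le_max_right t 0)

/-- The evolution of the initial datum under the linear part. -/
def linearPath (h : IsParabolicSystem c C a T) (x₀ : Seq) : Path :=
  ⟨fun k => BoundedContinuousFunction.ofNormedAddCommGroup
      (fun t : ℝ => Complex.exp (a k * (max t 0 : ℝ)) * x₀ k) (by fun_prop) ‖x₀ k‖
      (h.norm_cexp_mul_le x₀ k),
    memlp_of_le (summable_sq x₀) fun _ =>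
      BoundedContinuousFunction.norm_ofNormedAddCommGroup_le _ (norm_nonneg _) _⟩

lemma norm_linearPath_le (h : IsParabolicSystem c C a T) (x₀ : Seq) :
    ‖h.linearPath x₀‖ ≤ ‖x₀‖ := by
  refine (pow_le_pow_iff_left₀ (norm_nonneg _) (norm_nonneg _) two_ne_zero).1 ?_
  rw [norm_sq_eq_tsum x₀]
  exact norm_sq_le_tsum _ (summable_sq x₀) fun k =>
    (BoundedContinuousFunction.norm_le (norm_nonneg _)).2 (h.norm_cexp_mul_le x₀ k)

/-- Small data give global solutions. -/
theorem exists_solution (h : IsParabolicSystem c C a T) {x₀ : Seq}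
    (hx₀ : 8 * (C / c * Real.sqrt (∑' k : ℤ, (|(k : ℝ)|⁻¹) ^ 2) * ‖x₀‖) ≤ 1) :
    ∃ x : ℝ → Seq, Continuous x ∧ x 0 = x₀ ∧ SolvesSystem a T x := by
  have hc := h.pos
  have hC := h.nonneg
  have hQ0 : h.duhamelPath 0 = 0 := by
    ext k t
    have h2 (s : ℝ) : T k (Path.eval 0 s) = 0 := h.map_zero k
    simp [duhamelPath, duhamel, h2]
  obtain ⟨v, hv⟩ := exists_eq_add_quadratic (Q := h.duhamelPath) (x₀ := h.linearPath x₀)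
    (by positivity) hQ0 h.norm_duhamelPath_sub_le (by
      refine le_trans ?_ hx₀
      gcongr
      exact h.norm_linearPath_le x₀)
  have hform (k : ℤ) (t : ℝ) : v.eval t k = Complex.exp (a k * (max t 0 : ℝ)) * x₀ k +
      duhamel (a k) (fun s => T k (v.eval s)) (max t 0) := by
    change v k t = _
    conv_lhs => rw [hv]
    rfl
  refine ⟨v.eval, v.continuous_eval, ?_, fun t ht k => ?_⟩
  · ext k
    simp [hform, duhamel_zero]
  · have hd := ((hasDerivAt_cexp_mul (a k) t).mul_const (x₀ k)).add (hasDerivAt_duhamel (a k)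
      ((h.continuous_map k).comp v.continuous_eval) t)
    refine (hd.hasDerivWithinAt.congr_deriv ?_).congr (fun s hs => ?_) ?_
    · rw [hform, max_eq_left ht]
      simp only [Function.comp_def]
      ring
    · rw [hform, max_eq_left hs]; rfl
    · rw [hform, max_eq_left ht]; rfl

/-! ### Uniqueness for parabolic systems -/

lemma tendsto_resolvent_sum (hc : 0 < c) :
    Tendsto (fun μ : ℝ => ∑' k : ℤ, (|(k : ℝ)| / (μ + c * (k : ℝ) ^ 2)) ^ 2) atTop (𝓝 0) := by
  have h : Tendsto (fun μ : ℝ => ∑' k : ℤ, (|(k : ℝ)| / (μ + c * (k : ℝ) ^ 2)) ^ 2) atTop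
      (𝓝 (∑' _ : ℤ, (0 : ℝ))) := by
    refine tendsto_tsum_of_dominated_convergence (summable_inv_abs_sq.mul_left ((c⁻¹) ^ 2))
      (fun k => ?_) ?_
    · have h1 : Tendsto (fun μ : ℝ => |(k : ℝ)| / (μ + c * (k : ℝ) ^ 2)) atTop (𝓝 0) :=
        tendsto_const_nhds.div_atTop (tendsto_atTop_add_const_right _ _ tendsto_id)
      simpa using h1.pow 2
    · filter_upwards [eventually_ge_atTop 0] with μ hμ k
      rw [norm_pow, Real.norm_of_nonneg (by positivity), ← mul_pow]
      refine pow_le_pow_left₀ (by positivity) ?_ 2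
      rcases eq_or_ne k 0 with rfl | hk
      · simp
      have hk0 : 0 < |(k : ℝ)| := one_pos.trans_le (one_le_abs hk)
      rw [← mul_inv, ← one_div, div_le_div_iff₀ (by positivity) (by positivity)]
      nlinarith [sq_abs (k : ℝ)]
  simpa using h

lemma summable_resolvent (hc : 0 < c) {μ : ℝ} (hμ : 0 ≤ μ) :
    Summable fun k : ℤ => (|(k : ℝ)| / (μ + c * (k : ℝ) ^ 2)) ^ 2 := by
  refine Summable.of_nonneg_of_le (fun _ => by positivity) (fun k => ?_)
    (summable_inv_abs_sq.mul_left ((c⁻¹) ^ 2))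
  rw [← mul_pow]
  refine pow_le_pow_left₀ (by positivity) ?_ 2
  rcases eq_or_ne k 0 with rfl | hk
  · simp
  have hk0 : 0 < |(k : ℝ)| := one_pos.trans_le (one_le_abs hk)
  rw [← mul_inv, ← one_div, div_le_div_iff₀ (by positivity) (by positivity)]
  nlinarith [sq_abs (k : ℝ)]

/-- Unconditional uniqueness of continuous solutions. -/
theorem unique_solution (h : IsParabolicSystem c C a T) {x y : ℝ → Seq}
    (hx : ContinuousOn x (Set.Ici 0)) (hy : ContinuousOn y (Set.Ici 0)) (h0 : x 0 = y 0)
    (hxs : SolvesSystem a T x) (hys : SolvesSystem a T y) {t : ℝ} (ht : 0 ≤ t) : x t = y t := by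
  have hc := h.pos
  have hC := h.nonneg
  have hsub : Set.Icc 0 t ⊆ Set.Ici 0 := Set.Icc_subset_Ici_self
  obtain ⟨R₁, hR₁⟩ := isCompact_Icc.exists_bound_of_continuousOn (hx.mono hsub)
  obtain ⟨R₂, hR₂⟩ := isCompact_Icc.exists_bound_of_continuousOn (hy.mono hsub)
  set R := R₁ + R₂ with hR
  have hR0 : 0 ≤ R := by
    have h1 := (norm_nonneg _).trans (hR₁ 0 ⟨le_rfl, ht⟩)
    have h2 := (norm_nonneg _).trans (hR₂ 0 ⟨le_rfl, ht⟩)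
    linarith
  -- A large μ replaces both smallness of the solutions and a subdivision of the time interval.
  obtain ⟨μ, hμ1, hμ⟩ : ∃ μ : ℝ, 1 ≤ μ ∧
      (C * R) ^ 2 * ∑' k : ℤ, (|(k : ℝ)| / (μ + c * (k : ℝ) ^ 2)) ^ 2 < 1 / 4 := by
    have h1 := (tendsto_resolvent_sum hc).const_mul ((C * R) ^ 2)
    rw [mul_zero] at h1
    exact ((eventually_ge_atTop 1).and (h1.eventually_lt_const (by norm_num))).exists
  -- At a maximum s of the weighted difference, the mode-by-mode bounds sum to ‖x s - y s‖² ≤ ¼ ‖x s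
  -- - y s‖², which forces the difference to vanish on the whole interval.
  obtain ⟨s, hs, hmax⟩ := isCompact_Icc.exists_isMaxOn (Set.nonempty_Icc.2 ht)
    (f := fun s => Real.exp (-(μ * s)) * ‖x s - y s‖)
    ((by fun_prop : Continuous fun s => Real.exp (-(μ * s))).continuousOn.mul
      ((hx.mono hsub).sub (hy.mono hsub)).norm)
  set A := Real.exp (-(μ * s)) * ‖x s - y s‖ with hA
  have hA0 : 0 ≤ A := by positivity
  have hexp (r : ℝ) : Real.exp (μ * r) * Real.exp (-(μ * r)) = 1 := by
    rw [← Real.exp_add]; simp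
  have hle (r : ℝ) (hr : r ∈ Set.Icc 0 t) : ‖x r - y r‖ ≤ A * Real.exp (μ * r) := by
    have h1 : Real.exp (-(μ * r)) * ‖x r - y r‖ ≤ A := hmax hr
    calc ‖x r - y r‖ = Real.exp (μ * r) * (Real.exp (-(μ * r)) * ‖x r - y r‖) := by
          rw [← mul_assoc, hexp, one_mul]
      _ ≤ Real.exp (μ * r) * A := by gcongr
      _ = _ := mul_comm _ _
  have hAs : A * Real.exp (μ * s) = ‖x s - y s‖ := by
    rw [hA, mul_right_comm, mul_comm (Real.exp _) (Real.exp _), hexp, one_mul]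
  have hmode (k : ℤ) : ‖(x s - y s) k‖ ≤
      C * R * (A * Real.exp (μ * s)) * (|(k : ℝ)| / (μ + c * (k : ℝ) ^ 2)) := by
    have hk2 : 0 ≤ c * (k : ℝ) ^ 2 := by positivity
    have hre := h.re_le k
    have := norm_le_of_linear_ode (a := a k) (w := fun r => x r k - y r k)
      (g := fun r => T k (x r) - T k (y r)) (M := C * |(k : ℝ)| * (R * A)) (μ := μ) (T := t)
      (by linarith) (fun r hr => ((hxs r hr k).sub (hys r hr k)).congr_deriv (by ring))
      (by simp [h0]) (by positivity)
      (fun r hr hrt => (h.lipschitz k _ _).trans (by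
        have h1 := hR₁ r ⟨hr, hrt⟩
        have h2 := hR₂ r ⟨hr, hrt⟩
        have h3 := hle r ⟨hr, hrt⟩
        calc _ ≤ C * |(k : ℝ)| * (R * (A * Real.exp (μ * r))) := by
              gcongr
              linarith
          _ = _ := by ring)) hs.1 hs.2
    refine this.trans ?_
    calc _ ≤ C * |(k : ℝ)| * (R * A) * Real.exp (μ * s) / (μ + c * (k : ℝ) ^ 2) := by
          gcongr
          linarith
      _ = _ := by ring
  rw [hAs] at hmode
  have hsum := (summable_resolvent hc (zero_le_one.trans hμ1)).mul_left
    ((C * R * ‖x s - y s‖) ^ 2)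
  have hsq := norm_sq_le_tsum _ (by simpa only [mul_pow] using hsum) hmode
  have hfac : ∑' k : ℤ, (C * R * ‖x s - y s‖ * (|(k : ℝ)| / (μ + c * (k : ℝ) ^ 2))) ^ 2 =
      ((C * R) ^ 2 * ∑' k : ℤ, (|(k : ℝ)| / (μ + c * (k : ℝ) ^ 2)) ^ 2) * ‖x s - y s‖ ^ 2 := by
    rw [← tsum_mul_left, ← tsum_mul_right]
    exact tsum_congr fun k => by ring
  rw [hfac] at hsq
  have hzero : ‖x s - y s‖ = 0 := by
    have := sq_nonneg ‖x s - y s‖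
    exact pow_eq_zero_iff two_ne_zero |>.1 (by nlinarith)
  have hfin := hle t ⟨ht, le_rfl⟩
  rw [hA, hzero] at hfin
  simpa [sub_eq_zero] using hfin

end IsParabolicSystem

/-! ### Symbols -/

/-- `A` is a Fourier multiplier of order at most `p`. -/
def IsMult (A : (ℤ → ℂ) → ℤ → ℂ) (p : ℕ) : Prop :=
  ∃ m : ℤ → ℂ, HasOrder m p ∧ ∀ u, A u = mult m u

namespace IsMult

variable {A B : (ℤ → ℂ) → ℤ → ℂ} {p q : ℕ}

lemma comp (hA : IsMult A p) (hB : IsMult B q) : IsMult (fun u => A (B u)) (p + q) := by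
  obtain ⟨m, hm, hA⟩ := hA
  obtain ⟨n, hn, hB⟩ := hB
  refine ⟨_, hm.mul hn, fun u => ?_⟩
  ext k
  simp only [hA, hB, mult]
  ring

lemma id : IsMult (fun u => u) 0 :=
  ⟨fun _ => 1, ⟨1, zero_le_one, fun k => by simp⟩, fun u => by ext k; simp [mult]⟩

lemma dxi : IsMult dxi 1 :=
  ⟨fun k => Complex.I * k, ⟨1, zero_le_one, fun k => by simpa using abs_le_jap k⟩, fun _ => rfl⟩

lemma lam : IsMult lam 1 :=
  ⟨fun k => ((|(k : ℝ)| : ℝ) : ℂ), ⟨1, zero_le_one, fun k => by simpa using abs_le_jap k⟩,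
    fun _ => rfl⟩

lemma hilb : IsMult hilb 0 := by
  refine ⟨fun k => -Complex.I * ((Int.sign k : ℤ) : ℂ), ⟨1, zero_le_one, fun k => ?_⟩,
    fun _ => rfl⟩
  rcases lt_trichotomy k 0 with h | rfl | h
  · simp [Int.sign_eq_neg_one_of_neg h]
  · simp
  · simp [Int.sign_eq_one_of_pos h]

/-- Order 0 rather than 1 is what keeps the β-terms within the four derivatives allowed on the
second factor. -/
lemma tee {Υ : ℝ} (hΥ : 0 < Υ) : IsMult (tee Υ) 0 := by
  refine ⟨fun k => ((|(k : ℝ)| / (1 + Υ * |(k : ℝ)|) : ℝ) : ℂ), ⟨Υ⁻¹, by positivity, fun k => ?_⟩,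
    fun _ => rfl⟩
  rw [Complex.norm_real, Real.norm_of_nonneg (by positivity), pow_zero, mul_one, ← one_div,
    div_le_div_iff₀ (by positivity) hΥ]
  linarith

lemma quad_prod (hA : IsMult A p) (hB : IsMult B q) (hp : p ≤ 2 := by norm_num)
    (hq : q ≤ 4 := by norm_num) : QuadBounded fun u => prod (A u) (B u) := by
  obtain ⟨m, hm, hA⟩ := hA
  obtain ⟨n, hn, hB⟩ := hB
  simpa only [hA, hB] using QuadBounded.prod (hm.mono hp) (hn.mono hq)

lemma quad_lam_prod (hA : IsMult A p) (hB : IsMult B q) (hp : p ≤ 3 := by norm_num)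
    (hq : q ≤ 3 := by norm_num) : QuadBounded fun u => Hydroelastic.lam (prod (A u) (B u)) := by
  obtain ⟨m, hm, hA⟩ := hA
  obtain ⟨n, hn, hB⟩ := hB
  simpa only [hA, hB] using QuadBounded.lam_prod (hm.mono hp) (hn.mono hq)

lemma quad_commLam (hA : IsMult A p) (hB : IsMult B q) (hp : p ≤ 1 := by norm_num)
    (hq : q ≤ 4 := by norm_num) : QuadBounded fun u => commLam (A u) (B u) := by
  obtain ⟨m, hm, hA⟩ := hA
  obtain ⟨n, hn, hB⟩ := hB
  simpa only [hA, hB] using QuadBounded.commLam (hm.mono hp) (hn.mono hq)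

end IsMult

lemma lam_sub (u v : ℤ → ℂ) : lam (u - v) = lam u - lam v := by
  ext k
  simp only [lam, Pi.sub_apply]
  ring

lemma quadBounded_nonlinearPart {Υ : ℝ} (hΥ : 0 < Υ) (δ β : ℝ) :
    QuadBounded (nonlinearPart Υ δ β) := by
  have hT := IsMult.tee hΥ
  have d2 := IsMult.dxi.comp IsMult.dxi
  have d3 := IsMult.dxi.comp d2
  have d4 := IsMult.dxi.comp d3
  have q1 := ((IsMult.dxi.quad_lam_prod IsMult.dxi).sub
    (IsMult.lam.quad_lam_prod IsMult.lam)).smul (1 / 2)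
  have q2 := IsMult.dxi.quad_commLam IsMult.dxi
  have q3 := d2.quad_prod IsMult.lam
  have q4 := IsMult.id.quad_commLam hT
  have q5 := IsMult.dxi.quad_prod (IsMult.hilb.comp hT)
  have q6 := ((IsMult.id.quad_commLam (hT.comp d4)).sub
    (IsMult.dxi.quad_prod (IsMult.lam.comp (hT.comp d3)))).smul ((β / 4 : ℝ) : ℂ)
  have q7 := ((IsMult.id.quad_commLam (hT.comp d3)).sub
    (IsMult.dxi.quad_prod (IsMult.lam.comp (hT.comp d2)))).smul (δ : ℂ)
  have h := (((((q1.sub q2).add q3).add q4).sub q5).add q6).add q7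
  simp only [← lam_sub] at h
  exact h

/-- The symbol of `α + γ ℋ`. -/
def projSymb (Υ δ : ℝ) (k : ℤ) : ℂ :=
  (alphaSymb Υ δ k : ℂ) + (gammaSymb Υ δ k : ℂ) * (-Complex.I * ((Int.sign k : ℤ) : ℂ))

lemma alphaGammaH_apply (Υ δ : ℝ) (u : ℤ → ℂ) (k : ℤ) :
    alphaGammaH Υ δ u k = projSymb Υ δ k * u k := by
  simp only [alphaGammaH, projSymb, hilb]
  ring

lemma projSymb_zero (Υ δ : ℝ) : projSymb Υ δ 0 = 0 := by simp [projSymb, alphaSymb]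

lemma norm_projSymb_mul_le {Υ δ : ℝ} (hΥ : 0 < Υ) (hδ : 0 < δ) (k : ℤ) :
    jap k ^ 3 * ‖projSymb Υ δ k‖ ≤ 12 / δ := by
  rcases eq_or_ne k 0 with rfl | hk
  · rw [projSymb_zero, norm_zero, mul_zero]; positivity
  have hs : ‖-Complex.I * ((Int.sign k : ℤ) : ℂ)‖ = 1 := by
    rcases hk.lt_or_gt with h | h
    · simp [Int.sign_eq_neg_one_of_neg h]
    · simp [Int.sign_eq_one_of_pos h]
  have hj := pow_le_pow_left₀ (jap_pos k).le (jap_le_two_mul_abs hk) 3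
  have h1 := one_le_abs hk
  set κ := |(k : ℝ)| with hκ
  have hκ0 : 0 < κ := one_pos.trans_le h1
  have hα : ‖(alphaSymb Υ δ k : ℂ)‖ ≤ 1 / (δ * κ ^ 3) := by
    rw [Complex.norm_real, alphaSymb, ← hκ, Real.norm_eq_abs, abs_div, abs_neg,
      abs_of_pos (by positivity), abs_of_pos (by positivity),
      div_le_div_iff₀ (by positivity) (by positivity)]
    -- The denominator is at least δ²κ⁴.
    nlinarith [sq_nonneg (1 + Υ * κ)]
  have hγ : ‖(gammaSymb Υ δ k : ℂ)‖ ≤ 1 / (2 * (δ * κ ^ 3)) := by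
    rw [Complex.norm_real, gammaSymb, ← hκ, Real.norm_eq_abs, abs_of_pos (by positivity),
      div_le_div_iff₀ (by positivity) (by positivity)]
    -- By AM–GM the denominator factor δ²κ⁴ + 4(1+Υκ)² is at least 4δκ²(1+Υκ).
    nlinarith [mul_nonneg hκ0.le (sq_nonneg (δ * κ ^ 2 - 2 * (1 + Υ * κ)))]
  have hP : ‖projSymb Υ δ k‖ ≤ 1 / (δ * κ ^ 3) + 1 / (2 * (δ * κ ^ 3)) := by
    refine (norm_add_le _ _).trans (add_le_add hα ?_)
    rw [norm_mul, hs, mul_one]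
    exact hγ
  calc _ ≤ (2 * κ) ^ 3 * (1 / (δ * κ ^ 3) + 1 / (2 * (δ * κ ^ 3))) := by gcongr
    _ = 12 / δ := by field_simp; norm_num

/-- The symbol of the linear part. -/
def linSymb (Υ δ β : ℝ) (k : ℤ) : ℂ :=
  ((-((1 + Υ * |(k : ℝ)|) * (k : ℝ) ^ 2) + β / 4 * |(k : ℝ)| * (k : ℝ) ^ 4 + |(k : ℝ)| : ℝ) : ℂ) +
    ((-(δ * |(k : ℝ)| * (k : ℝ) ^ 3) : ℝ) : ℂ) * Complex.I

lemma linearPart_apply (Υ δ β : ℝ) (u : ℤ → ℂ) (k : ℤ) :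
    linearPart Υ δ β u k = linSymb Υ δ β k * u k := by
  simp only [linearPart, linSymb, dxi, lam, Pi.add_apply, Pi.smul_apply, smul_eq_mul]
  push_cast
  linear_combination (norm := ring_nf) (((1 + Υ * (|(k : ℝ)| : ℝ)) * (k : ℂ) ^ 2 +
    β / 4 * (|(k : ℝ)| : ℝ) * (k : ℂ) ^ 4 * (Complex.I ^ 2 - 1) +
    δ * (|(k : ℝ)| : ℝ) * (k : ℂ) ^ 3 * Complex.I) * u k) * Complex.I_sq

/-- The rate of dissipation of the linear part. -/
def dissipation (Υ δ β : ℝ) : ℝ := δ * β / 4 / (δ ^ 2 + 4 * (1 + Υ) ^ 2)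

/-- Since α < 0 off the zero mode, the β-term and ΛF are damped. The product of α with (I+ΥΛ)∂² has
the wrong sign, but the product of γℋ with δΛ∂³ is twice as large and of the opposite sign. -/
lemma re_symbol_le {Υ δ β : ℝ} (hΥ : 0 < Υ) (hδ : 0 < δ) (hβ : 0 < β) (k : ℤ) :
    (projSymb Υ δ k * linSymb Υ δ β k).re ≤ -(dissipation Υ δ β * (k : ℝ) ^ 2) := by
  rcases eq_or_ne k 0 with rfl | hk
  · simp [projSymb_zero]
  have h1 := one_le_abs hk
  have hsg : ((Int.sign k : ℤ) : ℝ) * (k : ℝ) ^ 3 = |(k : ℝ)| ^ 3 := by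
    rcases hk.lt_or_gt with h | h
    · rw [Int.sign_eq_neg_one_of_neg h, abs_of_neg (by exact_mod_cast h)]; push_cast; ring
    · rw [Int.sign_eq_one_of_pos h, abs_of_pos (by exact_mod_cast h)]; push_cast; ring
  have h2 : (k : ℝ) ^ 2 = |(k : ℝ)| ^ 2 := (sq_abs _).symm
  have h4 : (k : ℝ) ^ 4 = |(k : ℝ)| ^ 4 := by
    rw [show (k : ℝ) ^ 4 = ((k : ℝ) ^ 2) ^ 2 by ring, h2]; ring
  have hre : (projSymb Υ δ k * linSymb Υ δ β k).re =
      alphaSymb Υ δ k * (-((1 + Υ * |(k : ℝ)|) * (k : ℝ) ^ 2) + β / 4 * |(k : ℝ)| * (k : ℝ) ^ 4 +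
        |(k : ℝ)|) - gammaSymb Υ δ k * δ * |(k : ℝ)| * (((Int.sign k : ℤ) : ℝ) * (k : ℝ) ^ 3) := by
    have hmul (a g s p q : ℝ) : (((a : ℂ) + g * (-Complex.I * s)) * (p + q * Complex.I)).re =
        a * p + g * s * q := by
      simp [Complex.mul_re, Complex.mul_im]
    rw [projSymb, linSymb, ← Complex.ofReal_intCast, hmul]
    ring
  rw [hre, hsg, h2, h4, alphaSymb, gammaSymb, dissipation]
  set κ := |(k : ℝ)| with hκ
  have hκ0 : 0 < κ := one_pos.trans_le h1
  set D := δ ^ 2 * κ ^ 4 + 4 * (1 + Υ * κ) ^ 2 with hD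
  have hD0 : 0 < D := by positivity
  -- Since κ ≥ 1; with the κ⁶ of the β-term this gives the rate κ² and the constant in
  -- `dissipation`.
  have hDle : D ≤ (δ ^ 2 + 4 * (1 + Υ) ^ 2) * κ ^ 4 := by
    have h3 : 1 + Υ * κ ≤ (1 + Υ) * κ ^ 2 := by nlinarith [mul_pos hΥ hκ0]
    have h5 : (1 + Υ * κ) ^ 2 ≤ ((1 + Υ) * κ ^ 2) ^ 2 := by gcongr
    rw [hD]
    nlinarith
  have hid : -(δ * κ) / D * (-((1 + Υ * κ) * κ ^ 2) + β / 4 * κ * κ ^ 4 + κ) -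
      2 * (1 + Υ * κ) / (κ * D) * δ * κ * κ ^ 3 =
      -((δ * β / 4 * κ ^ 6 + δ * ((1 + Υ * κ) * κ ^ 3 + κ ^ 2)) / D) := by
    field_simp
    ring
  rw [hid, neg_le_neg_iff, div_mul_eq_mul_div, div_le_div_iff₀ (by positivity) hD0]
  calc δ * β / 4 * κ ^ 2 * D ≤ δ * β / 4 * κ ^ 2 * ((δ ^ 2 + 4 * (1 + Υ) ^ 2) * κ ^ 4) := by gcongr
    _ = δ * β / 4 * κ ^ 6 * (δ ^ 2 + 4 * (1 + Υ) ^ 2) := by ring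
    _ ≤ _ := by
      gcongr
      have : 0 ≤ δ * ((1 + Υ * κ) * κ ^ 3 + κ ^ 2) := by positivity
      linarith

/-! ### The model as a parabolic system -/

/-- The symbol of the linear part of the evolution. -/
def evolSymb (ε Υ δ β : ℝ) (k : ℤ) : ℂ :=
  ((1 / ε : ℝ) : ℂ) * (projSymb Υ δ k * linSymb Υ δ β k)

/-- The nonlinearity in terms of the weighted coefficients. -/
def evolNonlin (Υ δ β : ℝ) (k : ℤ) (x : Seq) : ℂ :=
  -(((jap k ^ 3 : ℝ) : ℂ) * (projSymb Υ δ k * nonlinearPart Υ δ β (unweight x) k))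

lemma weight_ne_zero (k : ℤ) : ((jap k ^ 3 : ℝ) : ℂ) ≠ 0 :=
  Complex.ofReal_ne_zero.2 (pow_pos (jap_pos k) 3).ne'

lemma weight_mul_unweight (x : Seq) (k : ℤ) : ((jap k ^ 3 : ℝ) : ℂ) * unweight x k = x k :=
  mul_div_cancel₀ _ (weight_ne_zero k)

lemma weight_mul_modelRHS (ε Υ δ β : ℝ) (x : Seq) (k : ℤ) :
    ((jap k ^ 3 : ℝ) : ℂ) * modelRHS ε Υ δ β (unweight x) k =
      evolSymb ε Υ δ β k * x k + evolNonlin Υ δ β k x := by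
  rw [← weight_mul_unweight x k, modelRHS, Pi.sub_apply, Pi.smul_apply, alphaGammaH_apply,
    alphaGammaH_apply, linearPart_apply, evolSymb, evolNonlin, smul_eq_mul]
  ring

/-- C is chosen before ε, which enters only the linear part; this is why the smallness condition
concerns ε‖F₀‖. -/
lemma exists_isParabolicSystem {Υ δ β : ℝ} (hΥ : 0 < Υ) (hδ : 0 < δ) (hβ : 0 < β) :
    ∃ C : ℝ, 0 ≤ C ∧ ∀ ε : ℝ, 0 < ε → IsParabolicSystem (dissipation Υ δ β / ε) C
      (evolSymb ε Υ δ β) (evolNonlin Υ δ β) := by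
  obtain ⟨C, hC, hN⟩ := (quadBounded_nonlinearPart hΥ δ β).exists_lipschitz
  refine ⟨12 / δ * C, by positivity, fun ε hε => ⟨?_, by positivity, fun k => ?_, fun k => ?_,
    fun k x y => ?_⟩⟩
  · rw [dissipation]; positivity
  · rw [evolSymb, Complex.re_ofReal_mul]
    calc _ ≤ 1 / ε * -(dissipation Υ δ β * (k : ℝ) ^ 2) := by
          gcongr; exact re_symbol_le hΥ hδ hβ k
      _ = _ := by ring
  · rcases eq_or_ne k 0 with rfl | hk
    · simp [evolNonlin, projSymb_zero]
    · simp [evolNonlin, (hN k hk).1]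
  · rcases eq_or_ne k 0 with rfl | hk
    · simp [evolNonlin, projSymb_zero]
    · have hid : evolNonlin Υ δ β k x - evolNonlin Υ δ β k y =
          -((((jap k ^ 3 : ℝ) : ℂ) * projSymb Υ δ k) * (nonlinearPart Υ δ β (unweight x) k -
            nonlinearPart Υ δ β (unweight y) k)) := by
        rw [evolNonlin, evolNonlin]; ring
      rw [hid, norm_neg, norm_mul, norm_mul, Complex.norm_real,
        Real.norm_of_nonneg (pow_nonneg (jap_pos k).le 3)]
      calc _ ≤ 12 / δ * (C * |(k : ℝ)| * ((‖x‖ + ‖y‖) * ‖x - y‖)) := by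
            gcongr
            exacts [norm_projSymb_mul_le hΥ hδ k, (hN k hk).2 x y]
        _ = _ := by ring

/-! ### `H³` functions and weighted sequences -/

lemma coeff_eq_repr (f : L2Torus) (k : ℤ) : coeff f k = fourierBasis.repr f k :=
  (fourierBasis_repr f k).symm

lemma coeff_injective : Function.Injective coeff := by
  intro f g h
  refine fourierBasis.repr.injective ?_
  ext k
  rw [← coeff_eq_repr, ← coeff_eq_repr, h]

lemma coeff_sub (f g : L2Torus) : coeff (f - g) = coeff f - coeff g := by
  ext k
  simp only [coeff_eq_repr, map_sub, lp.coeFn_sub, Pi.sub_apply]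

lemma unweight_sub (x y : Seq) : unweight (x - y) = unweight x - unweight y := by
  ext k
  simp only [unweight, lp.coeFn_sub, Pi.sub_apply]
  ring

lemma sobolev_weight (f : L2Torus) (k : ℤ) :
    (1 + (k : ℝ) ^ 2) ^ (3 : ℝ) * ‖coeff f k‖ ^ 2 =
      ‖((jap k ^ 3 : ℝ) : ℂ) * coeff f k‖ ^ 2 := by
  rw [norm_mul, Complex.norm_real, Real.norm_of_nonneg (pow_nonneg (jap_pos k).le 3), mul_pow,
    ← pow_mul, mul_comm 3 2, pow_mul, jap_sq, ← Real.rpow_natCast _ 3]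
  norm_num

lemma sobolev_of_coeff_eq {f : L2Torus} {x : Seq} (h : coeff f = unweight x) :
    MemSobolev 3 f ∧ sobolevNorm 3 f = ‖x‖ := by
  have hk (k : ℤ) : (1 + (k : ℝ) ^ 2) ^ (3 : ℝ) * ‖coeff f k‖ ^ 2 = ‖x k‖ ^ 2 := by
    rw [sobolev_weight, h, weight_mul_unweight]
  refine ⟨(summable_sq x).congr fun k => (hk k).symm, ?_⟩
  rw [sobolevNorm, tsum_congr hk, ← norm_sq_eq_tsum, Real.sqrt_sq (norm_nonneg _)]

lemma MemSobolev.exists_seq {f : L2Torus} (hf : MemSobolev 3 f) :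
    ∃ x : Seq, coeff f = unweight x := by
  refine ⟨⟨fun k => ((jap k ^ 3 : ℝ) : ℂ) * coeff f k,
    memlp_two (hf.congr fun k => sobolev_weight f k)⟩, ?_⟩
  ext k
  exact (mul_div_cancel_left₀ _ (weight_ne_zero k)).symm

lemma exists_coeff_eq (x : Seq) : ∃ f : L2Torus, coeff f = unweight x := by
  have hm : Memℓp (E := fun _ : ℤ => ℂ) (unweight x) 2 :=
    memlp_of_le (summable_sq x) fun k => by
      rw [norm_unweight]
      exact div_le_self (norm_nonneg _) (one_le_pow₀ (one_le_jap k))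
  refine ⟨fourierBasis.repr.symm ⟨unweight x, hm⟩, ?_⟩
  ext k
  rw [coeff_eq_repr, LinearIsometryEquiv.apply_symm_apply]

lemma IsGlobalSolution.exists_seq {ε Υ δ β : ℝ} {F₀ : L2Torus} {F : ℝ → L2Torus}
    (hF : IsGlobalSolution ε Υ δ β F₀ F) : ∃ x : ℝ → Seq, ContinuousOn x (Set.Ici 0) ∧
      (∀ t, 0 ≤ t → coeff (F t) = unweight (x t)) ∧
      SolvesSystem (evolSymb ε Υ δ β) (evolNonlin Υ δ β) x := by
  -- A solution is unconstrained at negative times, so the sequence there is arbitrary.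
  have hex : ∀ t : ℝ, ∃ x : Seq, 0 ≤ t → coeff (F t) = unweight x := by
    intro t
    by_cases ht : 0 ≤ t
    · exact (hF.continuous.1 t ht).exists_seq.imp fun _ h _ => h
    · exact ⟨0, fun h => absurd h ht⟩
  choose x hx using hex
  refine ⟨x, fun t ht => tendsto_iff_norm_sub_tendsto_zero.2 ?_, hx, fun t ht k => ?_⟩
  · refine (hF.continuous.2 t ht).congr' ?_
    filter_upwards [self_mem_nhdsWithin] with s hs
    exact (sobolev_of_coeff_eq (by rw [coeff_sub, hx s hs, hx t ht, unweight_sub])).2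
  · have hw (s : ℝ) (hs : 0 ≤ s) : x s k = ((jap k ^ 3 : ℝ) : ℂ) * coeff (F s) k := by
      rw [hx s hs, weight_mul_unweight]
    have hd := (hF.equation t ht k).const_mul ((jap k ^ 3 : ℝ) : ℂ)
    rw [hx t ht, weight_mul_modelRHS] at hd
    exact hd.congr (fun s hs => hw s hs) (hw t ht)

lemma SolvesSystem.isGlobalSolution {ε Υ δ β : ℝ} {F₀ : L2Torus} {F : ℝ → L2Torus}
    {x : ℝ → Seq} (hx : SolvesSystem (evolSymb ε Υ δ β) (evolNonlin Υ δ β) x)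
    (hc : Continuous x) (hF : ∀ t, coeff (F t) = unweight (x t)) (h0 : F 0 = F₀) :
    IsGlobalSolution ε Υ δ β F₀ F where
  continuous := by
    refine ⟨fun t _ => (sobolev_of_coeff_eq (hF t)).1, fun t _ => ?_⟩
    have h := (tendsto_iff_norm_sub_tendsto_zero.1 (hc.tendsto t)).mono_left
      (nhdsWithin_le_nhds (s := Set.Ici 0))
    refine h.congr fun s => ?_
    exact (sobolev_of_coeff_eq (by rw [coeff_sub, hF s, hF t, unweight_sub])).2.symm
  initial := h0
  equation := by
    intro t ht k
    have hd := (hx t ht k).div_const ((jap k ^ 3 : ℝ) : ℂ)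
    rw [← weight_mul_modelRHS, mul_div_cancel_left₀ _ (weight_ne_zero k), ← hF t] at hd
    simp only [hF]
    rw [hF] at hd
    exact hd

/-! ### Complex conjugation -/

/-- The Fourier coefficients of the complex conjugate. -/
def conjCoeff (u : ℤ → ℂ) : ℤ → ℂ := fun k => (starRingEnd ℂ) (u (-k))

lemma coeff_star (f : L2Torus) : coeff (star f) = conjCoeff (coeff f) := by
  ext k
  rw [coeff, conjCoeff, coeff, fourierCoeff, fourierCoeff, ← integral_conj]
  refine integral_congr_ae ?_
  filter_upwards [Lp.coeFn_star f] with x hx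
  rw [hx, Pi.star_apply, smul_eq_mul, smul_eq_mul, map_mul, ← fourier_neg, neg_neg]
  rfl

lemma isRealValued_iff (f : L2Torus) : IsRealValued f ↔ star f = f := by
  constructor
  · intro h
    refine Lp.ext ?_
    filter_upwards [Lp.coeFn_star f, h] with x hx h0
    rw [hx, Pi.star_apply]
    exact Complex.conj_eq_iff_im.2 h0
  · intro h
    have h1 := Lp.coeFn_star f
    rw [h] at h1
    filter_upwards [h1] with x hx
    exact Complex.conj_eq_iff_im.1 hx.symm

lemma conjCoeff_add (u v : ℤ → ℂ) : conjCoeff (u + v) = conjCoeff u + conjCoeff v := by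
  ext k; simp [conjCoeff]

lemma conjCoeff_sub (u v : ℤ → ℂ) : conjCoeff (u - v) = conjCoeff u - conjCoeff v := by
  ext k; simp [conjCoeff]

lemma conjCoeff_smul {c : ℂ} (hc : (starRingEnd ℂ) c = c) (u : ℤ → ℂ) :
    conjCoeff (c • u) = c • conjCoeff u := by
  ext k; simp [conjCoeff, hc]

lemma dxi_conjCoeff (u : ℤ → ℂ) : dxi (conjCoeff u) = conjCoeff (dxi u) := by
  ext k; simp [dxi, conjCoeff]

lemma lam_conjCoeff (u : ℤ → ℂ) : lam (conjCoeff u) = conjCoeff (lam u) := by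
  ext k; simp [lam, conjCoeff]

lemma hilb_conjCoeff (u : ℤ → ℂ) : hilb (conjCoeff u) = conjCoeff (hilb u) := by
  ext k; simp [hilb, conjCoeff]

lemma tee_conjCoeff (Υ : ℝ) (u : ℤ → ℂ) : tee Υ (conjCoeff u) = conjCoeff (tee Υ u) := by
  ext k; simp [tee, conjCoeff]

lemma prod_conjCoeff (u v : ℤ → ℂ) :
    prod (conjCoeff u) (conjCoeff v) = conjCoeff (prod u v) := by
  ext k
  rw [prod, conjCoeff, prod, Complex.conj_tsum, ← (Equiv.neg ℤ).tsum_eq]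
  refine tsum_congr fun j => ?_
  simp only [conjCoeff, Equiv.neg_apply, map_mul, neg_neg]
  rw [show -(k - -j) = -k - j by ring]

lemma commLam_conjCoeff (u v : ℤ → ℂ) :
    commLam (conjCoeff u) (conjCoeff v) = conjCoeff (commLam u v) := by
  simp only [commLam, prod_conjCoeff, lam_conjCoeff, conjCoeff_sub]

lemma alphaGammaH_conjCoeff (Υ δ : ℝ) (u : ℤ → ℂ) :
    alphaGammaH Υ δ (conjCoeff u) = conjCoeff (alphaGammaH Υ δ u) := by
  ext k
  have ha : alphaSymb Υ δ (-k) = alphaSymb Υ δ k := by simp [alphaSymb]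
  have hg : gammaSymb Υ δ (-k) = gammaSymb Υ δ k := by simp [gammaSymb]
  rw [alphaGammaH, hilb_conjCoeff]
  simp [alphaGammaH, conjCoeff, ha, hg]

/-- Every multiplier involved satisfies m(-k) = conj m(k), and all scalar coefficients are real. -/
lemma modelRHS_conjCoeff (ε Υ δ β : ℝ) (u : ℤ → ℂ) :
    modelRHS ε Υ δ β (conjCoeff u) = conjCoeff (modelRHS ε Υ δ β u) := by
  have h2 : (starRingEnd ℂ) (1 / 2) = 1 / 2 := by
    simpa using Complex.conj_ofReal (1 / 2)
  simp only [modelRHS, linearPart, nonlinearPart, dxi_conjCoeff, lam_conjCoeff, hilb_conjCoeff,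
    tee_conjCoeff, prod_conjCoeff, commLam_conjCoeff, ← conjCoeff_add, ← conjCoeff_sub,
    ← conjCoeff_smul (Complex.conj_ofReal _), ← conjCoeff_smul h2, alphaGammaH_conjCoeff]

lemma sobolev_summand_star (s : ℝ) (f : L2Torus) (k : ℤ) :
    (1 + (k : ℝ) ^ 2) ^ s * ‖coeff (star f) k‖ ^ 2 =
      (1 + ((-k : ℤ) : ℝ) ^ 2) ^ s * ‖coeff f (-k)‖ ^ 2 := by
  rw [coeff_star, conjCoeff, RCLike.norm_conj]
  simp

lemma sobolevNorm_star (s : ℝ) (f : L2Torus) : sobolevNorm s (star f) = sobolevNorm s f := by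
  rw [sobolevNorm, sobolevNorm, tsum_congr (sobolev_summand_star s f)]
  exact congrArg Real.sqrt
    ((Equiv.neg ℤ).tsum_eq fun k : ℤ => (1 + (k : ℝ) ^ 2) ^ s * ‖coeff f k‖ ^ 2)

lemma MemSobolev.star {s : ℝ} {f : L2Torus} (hf : MemSobolev s f) : MemSobolev s (star f) :=
  ((Equiv.neg ℤ).summable_iff.2 hf).congr fun k => (sobolev_summand_star s f k).symm

lemma star_sub_L2Torus (f g : L2Torus) : star (f - g) = star f - star g := by
  refine coeff_injective ?_
  rw [coeff_star, coeff_sub, coeff_sub, coeff_star, coeff_star, conjCoeff_sub]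

/-- The complex conjugate of a solution is a solution. -/
lemma IsGlobalSolution.star {ε Υ δ β : ℝ} {F₀ : L2Torus} {F : ℝ → L2Torus}
    (hF : IsGlobalSolution ε Υ δ β F₀ F) :
    IsGlobalSolution ε Υ δ β (star F₀) fun t => star (F t) where
  continuous := by
    refine ⟨fun t ht => (hF.continuous.1 t ht).star, fun t ht => ?_⟩
    simpa only [← star_sub_L2Torus, sobolevNorm_star] using hF.continuous.2 t ht
  initial := congrArg _ hF.initial
  equation := by
    intro t ht k
    simp only [coeff_star, modelRHS_conjCoeff]
    exact (hF.equation t ht (-k)).star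

lemma IsGlobalSolution.eq {ε Υ δ β : ℝ} (hΥ : 0 < Υ) (hδ : 0 < δ) (hβ : 0 < β) (hε : 0 < ε)
    {F₀ : L2Torus} {F G : ℝ → L2Torus} (hF : IsGlobalSolution ε Υ δ β F₀ F)
    (hG : IsGlobalSolution ε Υ δ β F₀ G) {t : ℝ} (ht : 0 ≤ t) : F t = G t := by
  obtain ⟨C, -, hsys⟩ := exists_isParabolicSystem hΥ hδ hβ
  obtain ⟨x, hxc, hx, hxs⟩ := hF.exists_seq
  obtain ⟨y, hyc, hy, hys⟩ := hG.exists_seq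
  have h0 : x 0 = y 0 := by
    ext k
    rw [← weight_mul_unweight, ← weight_mul_unweight (y 0), ← hx 0 le_rfl, ← hy 0 le_rfl,
      hF.initial, hG.initial]
  refine coeff_injective ?_
  rw [hx t ht, hy t ht, (hsys ε hε).unique_solution hxc hyc h0 hxs hys ht]

end Hydroelastic

end

/-! ### The main theorem -/

theorem theorem6p3 (Υ δ β : ℝ) (hΥ : 0 < Υ) (hδ : 0 < δ) (hβ : 0 < β) :
    ∃ εstar : ℝ, 0 < εstar ∧
      ∀ ε : ℝ, 0 < ε →
      ∀ F₀ : Hydroelastic.L2Torus,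
        Hydroelastic.MemSobolev 3 F₀ →
        Hydroelastic.MeanZero F₀ →
        ε * Hydroelastic.sobolevNorm 3 F₀ ≤ εstar →
        ∃ F : ℝ → Hydroelastic.L2Torus,
          Hydroelastic.IsGlobalSolution ε Υ δ β F₀ F ∧
          (∀ G : ℝ → Hydroelastic.L2Torus,
            Hydroelastic.IsGlobalSolution ε Υ δ β F₀ G → ∀ τ : ℝ, 0 ≤ τ → G τ = F τ) ∧
          (Hydroelastic.IsRealValued F₀ →
            ∀ τ : ℝ, 0 ≤ τ → Hydroelastic.IsRealValued (F τ)) := by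
  obtain ⟨C, hC, hsys⟩ := Hydroelastic.exists_isParabolicSystem hΥ hδ hβ
  set c := Hydroelastic.dissipation Υ δ β with hc
  have hc0 : 0 < c := by rw [hc, Hydroelastic.dissipation]; positivity
  set K := 8 * (C / c * Real.sqrt (∑' k : ℤ, (|(k : ℝ)|⁻¹) ^ 2)) with hK
  have hK0 : 0 ≤ K := by positivity
  -- With rate c/ε the fixed point condition reads K ε‖x₀‖ ≤ 1; the added 1 covers K = 0.
  refine ⟨1 / (K + 1), by positivity, fun ε hε F₀ hF₀ _ hsmall => ?_⟩
  obtain ⟨x₀, hx₀⟩ := hF₀.exists_seq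
  rw [(Hydroelastic.sobolev_of_coeff_eq hx₀).2] at hsmall
  obtain ⟨x, hxc, hx0, hxs⟩ := (hsys ε hε).exists_solution (x₀ := x₀) (by
    calc _ = K * (ε * ‖x₀‖) := by rw [hK]; field_simp
      _ ≤ K * (1 / (K + 1)) := by gcongr
      _ ≤ 1 := by rw [mul_one_div, div_le_one (by positivity)]; linarith)
  choose F hF using fun t => Hydroelastic.exists_coeff_eq (x t)
  have hsol : Hydroelastic.IsGlobalSolution ε Υ δ β F₀ F :=
    hxs.isGlobalSolution hxc hF (Hydroelastic.coeff_injective (by rw [hF, hx0, hx₀]))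
  refine ⟨F, hsol, fun G hG τ hτ => hG.eq hΥ hδ hβ hε hsol hτ, fun hreal τ hτ => ?_⟩
  rw [Hydroelastic.isRealValued_iff] at hreal ⊢
  have hstar := hsol.star
  rw [hreal] at hstar
  exact hstar.eq hΥ hδ hβ hε hsol hτ
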